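/- Lemma 6.1 (Positivity). For complex $s,\beta$ let $l(s)=\pi^{-s/2}\cdot 2\Gamma(1+s/2)$ and $b(s,\beta)=\sin(\pi s/4)\,l(2\beta+s)\,(2\beta+s-1)$. Let $(x)_n=x(x+1)\cdots(x+n-1)$, and for an integer $w\ge 0$ put $$T_0(z,\beta,4w)=\frac{(-1)^{w+1}}{\pi^{1-\beta}\Gamma(1+\beta)}\sum_{k\ge w+1}\frac{(\pi z)^{2k}}{(1+\beta)_{2k}\,(2k+\beta-\tfrac12)},$$ $$P_{4w}(z,\beta)=\frac{(-1)^{w+1}}{\pi^{1-\beta}\Gamma(1+\beta)}\sum_{k\ge w+1}\frac{(-1)^k z^{2k}}{(1+\beta)_{2k}\,(2k+\beta-\tfrac12)\,\zeta(2\beta+4k)}.$$ Let $\beta\ge 0$ be real and let $w\ge 0$ be an integer. Both series converge absolutely for every complex $z$, and the following hold. (0) $T_0$ is the Mellin density of $(-1)^w/b(s,\beta)$: if $\max\{4w,\,1-2\beta\}<\operatorname{Re}(s)<4(w+1)$, then $$\frac{(-1)^w}{b(s,\beta)}=\int_0^\infty v^{s-1}\,T_0(i v^{-2},\beta,4w)\,dv,$$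 with an absolutely convergent integral. (1) If $P_{4w}(r,\beta)$ is positive for all $r>0$, then $T_0(ir,\beta,4w)$ is positive for all $r>0$. (2) $T_0(ir,\beta,4w)$ is positive for all $r>0$. (3) For all $r>0$, $$T_0(ir,\beta,4w)=\sum_{n\ge1}n^{-2\beta}\,P_{4w}(\pi r/n^2,\beta),$$ and the series converges absolutely. -/

import Mathlib

open scoped ComplexOrder

namespace ZetaMellin

noncomputable section

/-- `l(s) = π^{-s/2} · 2 Γ(1 + s/2)`, which is `π^{-s/2} s Γ(s/2)` with the removable singularity
at `s = 0` filled in. -/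
def l (s : ℂ) : ℂ := (Real.pi : ℂ) ^ (-s / 2) * (2 * Complex.Gamma (1 + s / 2))

/-- `n₀(s, β) = sin(πs/4) l(2β + s)`. -/
def n0 (s β : ℂ) : ℂ := Complex.sin (Real.pi * s / 4) * l (2 * β + s)

/-- `b(s, β) = n₀(s, β) (2β + s - 1)`. -/
def b (s β : ℂ) : ℂ := n0 s β * (2 * β + s - 1)

/-- The Pochhammer symbol `(z)_n = z (z + 1) ⋯ (z + n - 1)`. -/
def poch (z : ℂ) (n : ℕ) : ℂ := ∏ k ∈ Finset.range n, (z + k)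

/-- The term of index `k` in the series of `T₀(z, β, 4w)`. -/
def T0Term (z β : ℂ) (k : ℕ) : ℂ :=
  (Real.pi * z) ^ (2 * k) / (poch (1 + β) (2 * k) * (2 * k + β - 1 / 2))

/-- `T₀(z, β, 4w)`; the argument `w` stands for `4w`, and the sum runs over `k = j + (w + 1)`,
that is over all `k ≥ w + 1`. -/
def T0 (z β : ℂ) (w : ℕ) : ℂ :=
  (-1) ^ (w + 1) / ((Real.pi : ℂ) ^ (1 - β) * Complex.Gamma (1 + β)) *
    ∑' j : ℕ, T0Term z β (j + (w + 1))

/-- The term of index `k` in the series of `P_{4w}(z, β)`. -/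
def PTerm (z β : ℂ) (k : ℕ) : ℂ :=
  (-1) ^ k * z ^ (2 * k) /
    (poch (1 + β) (2 * k) * (2 * k + β - 1 / 2) * riemannZeta (2 * β + 4 * k))

/-- `P_{4w}(z, β)`; the sum runs over all `k ≥ w + 1`. -/
def P (w : ℕ) (z β : ℂ) : ℂ :=
  (-1) ^ (w + 1) / ((Real.pi : ℂ) ^ (1 - β) * Complex.Gamma (1 + β)) *
    ∑' j : ℕ, PTerm z β (j + (w + 1))

end

end ZetaMellin

/-!
Up to elementary factors `T₀(ir, β, 4w)` is the series `∑ (-1)^j x^(2j+2) / (Γ(a+2j+3) (2j+a+3/2))`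
at `x = πr`, with `a = β + 2w`. An Erdélyi–Kober average
`f ↦ Γ(q)⁻¹ ∫₀¹ y^(p-1) (1-y)^(q-1) f(xy) dy` multiplies the coefficient of `x^m` by
`Γ(p+m) / Γ(p+m+q)` and the Mellin transform at `s` by `Γ(p-s) / Γ(p-s+q)`. Two of them, with
`(p, q) = (1, a)` and `(a - 1/2, 1)`, turn `1 - cos x = ∑ (-1)^j x^(2j+2) / (2j+2)!` into the series
above, so positivity is inherited from `1 - cos ≥ 0` and the Mellin transform from that of
`1 - cos`. In the sum over `n` of the `P`-series, the powers of `n` in the `k`-th term add up to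
`ζ(2β+4k)`, which cancels the zeta factor.
-/

namespace ZetaMellin

open MeasureTheory Set Filter Topology
open scoped Real

section Mellin

variable {E : Type*} [NormedAddCommGroup E] [NormedSpace ℂ E]

lemma hasMellin_congr_Ioi {f g : ℝ → E} {s : ℂ} {m : E} (hf : HasMellin f s m)
    (h : EqOn f g (Ioi 0)) : HasMellin g s m := by
  have hfg : EqOn (fun x : ℝ => (x : ℂ) ^ (s - 1) • f x) (fun x => (x : ℂ) ^ (s - 1) • g x)
      (Ioi 0) := fun x hx => congrArg _ (h hx)
  exact ⟨IntegrableOn.congr_fun hf.1 hfg measurableSet_Ioi,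
    (setIntegral_congr_fun measurableSet_Ioi hfg).symm.trans hf.2⟩

lemma hasMellin_comp_rpow {f : ℝ → E} {s : ℂ} {m : E} {a : ℝ} (ha : a ≠ 0)
    (h : HasMellin f (s / a) m) : HasMellin (fun x => f (x ^ a)) s (|a|⁻¹ • m) :=
  ⟨(MellinConvergent.comp_rpow ha).2 h.1, by rw [mellin_comp_rpow, h.2]⟩

lemma hasMellin_comp_mul_left {f : ℝ → E} {s : ℂ} {m : E} {a : ℝ} (ha : 0 < a)
    (h : HasMellin f s m) : HasMellin (fun x => f (a * x)) s ((a : ℂ) ^ (-s) • m) :=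
  ⟨(MellinConvergent.comp_mul_left ha).2 h.1, by rw [mellin_comp_mul_left _ _ ha, h.2]⟩

lemma hasMellin_cpow_smul {f : ℝ → E} {s a : ℂ} {m : E} (h : HasMellin f (s + a) m) :
    HasMellin (fun x => (x : ℂ) ^ a • f x) s m :=
  ⟨MellinConvergent.cpow_smul.2 h.1, (mellin_cpow_smul f s a).trans h.2⟩

lemma hasMellin_const_mul {f : ℝ → ℂ} {s m : ℂ} (c : ℂ) (h : HasMellin f s m) :
    HasMellin (fun x => c * f x) s (c * m) := by
  have hc := hasMellin_const_smul h.1 c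
  rwa [h.2] at hc

lemma cpow_mul_superposition (f W : ℝ → ℂ) (s : ℂ) {x y : ℝ} (hx : 0 < x) (hy : 0 < y) :
    (x : ℂ) ^ (s - 1) * (W y * f (x * y)) =
      y * ((y : ℂ) ^ (1 - s - 1) * W y) * (((x * y : ℝ) : ℂ) ^ (s - 1) * f (x * y)) := by
  have hy0 : (y : ℂ) ≠ 0 := Complex.ofReal_ne_zero.2 hy.ne'
  have hpow : (y : ℂ) * (y : ℂ) ^ (1 - s - 1) * (y : ℂ) ^ (s - 1) = 1 := by
    nth_rewrite 1 [← Complex.cpow_one (y : ℂ)]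
    rw [← Complex.cpow_add _ _ hy0, ← Complex.cpow_add _ _ hy0,
      show 1 + (1 - s - 1) + (s - 1) = 0 by ring, Complex.cpow_zero]
  rw [Complex.ofReal_mul, Complex.mul_cpow_ofReal_nonneg hx.le hy.le]
  linear_combination (-(x : ℂ) ^ (s - 1) * (W y * f (x * y))) * hpow

lemma integrable_cpow_mul_superposition {f W : ℝ → ℂ} {s : ℂ} (hfm : Measurable f)
    (hWm : Measurable W) (hf : MellinConvergent f s) (hW : MellinConvergent W (1 - s)) :
    Integrable (fun p : ℝ × ℝ => (p.1 : ℂ) ^ (s - 1) * (W p.2 * f (p.1 * p.2)))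
      ((volume.restrict (Ioi 0)).prod (volume.restrict (Ioi 0))) := by
  set φ : ℝ → ℂ := fun t => (t : ℂ) ^ (s - 1) * f t
  set ψ : ℝ → ℂ := fun t => (t : ℂ) ^ (1 - s - 1) * W t
  have hkernel {y : ℝ} (hy : 0 < y) : EqOn (fun x => y * ψ y * φ (x * y))
      (fun x : ℝ => (x : ℂ) ^ (s - 1) * (W y * f (x * y))) (Ioi 0) :=
    fun x hx => (cpow_mul_superposition f W s hx hy).symm
  rw [integrable_prod_iff' (by fun_prop : Measurable _).aestronglyMeasurable]
  refine ⟨ae_restrict_of_forall_mem measurableSet_Ioi fun y hy => ?_, ?_⟩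
  · have hφ : IntegrableOn (fun x => φ (x * y)) (Ioi 0) :=
      (integrableOn_Ioi_comp_mul_right_iff φ 0 hy).2 (by rw [zero_mul]; exact hf)
    exact IntegrableOn.congr_fun (hφ.const_mul _) (hkernel hy) measurableSet_Ioi
  · have hψ : IntegrableOn (fun y => ‖ψ y‖ * ∫ x in Ioi (0 : ℝ), ‖φ x‖) (Ioi 0) :=
      hW.norm.mul_const _
    refine IntegrableOn.congr_fun hψ (fun y hy => ?_) measurableSet_Ioi
    have hy : 0 < y := hy
    calc ‖ψ y‖ * ∫ x in Ioi (0 : ℝ), ‖φ x‖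
        = ‖(y : ℂ) * ψ y‖ * ∫ x in Ioi (0 : ℝ), ‖φ (x * y)‖ := by
          rw [integral_comp_mul_right_Ioi (fun x => ‖φ x‖) 0 hy, norm_mul (y : ℂ),
            Complex.norm_real, Real.norm_of_nonneg hy.le, zero_mul, smul_eq_mul]
          field_simp
      _ = ∫ x in Ioi (0 : ℝ), ‖(x : ℂ) ^ (s - 1) * (W y * f (x * y))‖ := by
          rw [← integral_const_mul]
          exact setIntegral_congr_fun measurableSet_Ioi fun x hx =>
            (norm_mul _ _).symm.trans (congrArg norm (hkernel hy hx))

lemma hasMellin_superposition {f W : ℝ → ℂ} {s F G : ℂ} (hfm : Measurable f)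
    (hWm : Measurable W) (hf : HasMellin f s F) (hW : HasMellin W (1 - s) G) :
    HasMellin (fun x => ∫ y in Ioi (0 : ℝ), W y * f (x * y)) s (G * F) := by
  have hint := integrable_cpow_mul_superposition hfm hWm hf.1 hW.1
  refine ⟨hint.integral_prod_left.congr (ae_of_all _ fun x => ?_), ?_⟩
  · simp only [integral_const_mul, smul_eq_mul]
  calc mellin (fun x => ∫ y in Ioi (0 : ℝ), W y * f (x * y)) s
      = ∫ x in Ioi (0 : ℝ), ∫ y in Ioi (0 : ℝ), (x : ℂ) ^ (s - 1) * (W y * f (x * y)) := by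
        simp only [mellin, integral_const_mul, smul_eq_mul]
    _ = ∫ y in Ioi (0 : ℝ), ∫ x in Ioi (0 : ℝ), (x : ℂ) ^ (s - 1) * (W y * f (x * y)) :=
        integral_integral_swap hint
    _ = ∫ y in Ioi (0 : ℝ), ((y : ℂ) ^ (1 - s - 1) * W y) * mellin f s := by
        refine setIntegral_congr_fun measurableSet_Ioi fun y hy => ?_
        have hy : 0 < y := hy
        have hy0 : (y : ℂ) ≠ 0 := Complex.ofReal_ne_zero.2 hy.ne'
        have hscale := integral_comp_mul_right_Ioi (fun x : ℝ => (x : ℂ) ^ (s - 1) * f x) 0 hy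
        rw [setIntegral_congr_fun measurableSet_Ioi fun x (hx : 0 < x) =>
          cpow_mul_superposition f W s hx hy, integral_const_mul, hscale, zero_mul]
        simp only [Complex.real_smul, Complex.ofReal_inv, mellin, smul_eq_mul]
        field_simp
    _ = G * F := by
        rw [integral_mul_const, hf.2, ← hW.2]
        rfl

lemma hasMellin_exp_neg {s : ℂ} (hs : 0 < s.re) :
    HasMellin (fun x : ℝ => (Real.exp (-x) : ℂ)) s (Complex.Gamma s) := by
  refine ⟨?_, by rw [Complex.Gamma_eq_integral hs, Complex.GammaIntegral_eq_mellin]⟩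
  exact (Complex.GammaIntegral_convergent hs).congr_fun
    (fun x _ => mul_comm _ _) measurableSet_Ioi

lemma hasMellin_laplace {W : ℝ → ℂ} {s G : ℂ} (hWm : Measurable W) (hs : 0 < s.re)
    (hW : HasMellin W (1 - s) G) :
    HasMellin (fun x => ∫ y in Ioi (0 : ℝ), W y * Real.exp (-(x * y))) s (G * Complex.Gamma s) :=
  hasMellin_superposition (f := fun x : ℝ => (Real.exp (-x) : ℂ)) (by fun_prop) hWm
    (hasMellin_exp_neg hs) hW

end Mellin

lemma hasMellin_one_add_inv {s : ℂ} (h0 : 0 < s.re) (h1 : s.re < 1) :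
    HasMellin (fun x : ℝ => ((1 + x)⁻¹ : ℂ)) s (π / Complex.sin (π * s)) := by
  rw [← Complex.Gamma_mul_Gamma_one_sub, mul_comm]
  refine hasMellin_congr_Ioi (hasMellin_laplace (by fun_prop) h0
    (hasMellin_exp_neg (s := 1 - s) (by simpa using h1))) fun x hx => ?_
  have hx : 0 < x := hx
  calc ∫ y in Ioi (0 : ℝ), (Real.exp (-y) : ℂ) * Real.exp (-(x * y))
      = ((∫ y in Ioi (0 : ℝ), Real.exp (-(1 + x) * y) : ℝ) : ℂ) := by
        rw [← integral_complex_ofReal]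
        refine integral_congr_ae (ae_of_all _ fun y => ?_)
        simp only [← Complex.ofReal_mul, ← Real.exp_add]
        ring_nf
    _ = (1 + x : ℂ)⁻¹ := by
        rw [integral_exp_mul_Ioi (by linarith) 0]
        simp only [mul_zero, Real.exp_zero, neg_div_neg_eq, one_div]
        push_cast
        rfl

lemma hasMellin_one_add_sq_inv {s : ℂ} (h0 : 0 < s.re) (h1 : s.re < 2) :
    HasMellin (fun x : ℝ => ((1 + x ^ 2)⁻¹ : ℂ)) s (π / (2 * Complex.sin (π * s / 2))) := by
  have hre : (s / (2 : ℝ)).re = s.re / 2 := by simp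
  have h := hasMellin_comp_rpow (s := s) two_ne_zero
    (hasMellin_one_add_inv (s := s / (2 : ℝ)) (by rw [hre]; linarith) (by rw [hre]; linarith))
  convert h using 1
  · simp
  · rw [Complex.real_smul, abs_two]
    push_cast
    rw [mul_div_assoc]
    ring

lemma integral_cos_mul_exp_neg {x : ℝ} (hx : 0 < x) :
    IntegrableOn (fun y => Real.cos y * Real.exp (-(x * y))) (Ioi 0) ∧
      ∫ y in Ioi (0 : ℝ), Real.cos y * Real.exp (-(x * y)) = x / (1 + x ^ 2) := by
  have hneg : (-x + Complex.I).re < 0 := by simpa using hx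
  have hre (y : ℝ) : Real.cos y * Real.exp (-(x * y)) =
      (Complex.exp ((-x + Complex.I) * y)).re := by
    simp [Complex.exp_re, mul_comm]
  have hint := integrableOn_exp_mul_complex_Ioi hneg 0
  simp only [hre]
  refine ⟨hint.re, ?_⟩
  have hval := congrArg Complex.re (integral_exp_mul_complex_Ioi hneg 0)
  rw [show (∫ y in Ioi (0 : ℝ), (Complex.exp ((-x + Complex.I) * y)).re) = _ from
    integral_re hint]
  refine hval.trans ?_
  simp only [add_comm, Complex.ofReal_zero, mul_zero, Complex.exp_zero, Complex.div_re,
    Complex.neg_re, Complex.one_re, Complex.add_re, Complex.I_re, Complex.ofReal_re, add_zero,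
    mul_neg, neg_mul, one_mul, neg_neg, Complex.normSq_apply, Complex.add_im, Complex.I_im,
    Complex.neg_im, Complex.ofReal_im, neg_zero, zero_add, mul_one, Complex.one_im, zero_div]
  ring

lemma integral_one_sub_cos_mul_exp_neg {x : ℝ} (hx : 0 < x) :
    ∫ y in Ioi (0 : ℝ), (1 - Real.cos y) * Real.exp (-(x * y)) = x⁻¹ * (1 + x ^ 2)⁻¹ := by
  have hexp : ∫ y in Ioi (0 : ℝ), Real.exp (-(x * y)) = x⁻¹ := by
    simpa [← neg_mul, neg_div_neg_eq] using integral_exp_mul_Ioi (neg_neg_of_pos hx) 0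
  have hexpi : IntegrableOn (fun y => Real.exp (-(x * y))) (Ioi 0) := by
    simpa only [neg_mul] using integrableOn_exp_mul_Ioi (neg_neg_of_pos hx) 0
  obtain ⟨hcosi, hcos⟩ := integral_cos_mul_exp_neg hx
  simp only [sub_mul, one_mul]
  rw [integral_sub hexpi hcosi, hexp, hcos]
  field_simp
  ring

lemma mellinConvergent_one_sub_cos {s : ℂ} (h0 : -2 < s.re) (h1 : s.re < 0) :
    MellinConvergent (fun y : ℝ => ((1 - Real.cos y : ℝ) : ℂ)) s := by
  refine mellinConvergent_of_isBigO_rpow (a := 0) (b := -2)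
    ?_ ?_ h1 ?_ h0
  · exact (Continuous.locallyIntegrable (by fun_prop)).locallyIntegrableOn _
  · refine Asymptotics.IsBigO.of_bound 2 (Eventually.of_forall fun y => ?_)
    rw [Complex.norm_real, Real.norm_of_nonneg (sub_nonneg.2 y.cos_le_one)]
    simp only [neg_zero, Real.rpow_zero, norm_one]
    linarith [y.neg_one_le_cos]
  · refine Asymptotics.IsBigO.of_bound 1 (Eventually.of_forall fun y => ?_)
    rw [Complex.norm_real, Real.norm_of_nonneg (sub_nonneg.2 y.cos_le_one)]
    simp only [neg_neg, Real.rpow_two, norm_pow, Real.norm_eq_abs, sq_abs]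
    nlinarith [y.one_sub_sq_div_two_le_cos]

-- The value comes from the Laplace transform `x⁻¹ (1 + x²)⁻¹` of `1 - cos`, whose Mellin transform
-- is elementary: `hasMellin_laplace` relates the two by a Gamma factor.
lemma hasMellin_one_sub_cos {s : ℂ} (h0 : -2 < s.re) (h1 : s.re < 0) :
    HasMellin (fun y : ℝ => ((1 - Real.cos y : ℝ) : ℂ)) s
      (π / (2 * Complex.sin (π * -s / 2)) / Complex.Gamma (1 - s)) := by
  have hconv := mellinConvergent_one_sub_cos h0 h1
  refine ⟨hconv, ?_⟩
  have hre : 0 < (1 - s).re := by simpa using h1.trans one_pos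
  have hlaplace := hasMellin_laplace (W := fun y : ℝ => ((1 - Real.cos y : ℝ) : ℂ)) (s := 1 - s)
    (by fun_prop) hre
    (by rw [sub_sub_cancel]; exact ⟨hconv, rfl⟩)
  have hrational : HasMellin (fun x : ℝ => (x : ℂ) ^ (-1 : ℂ) • ((1 + x ^ 2)⁻¹ : ℂ)) (1 - s)
      (π / (2 * Complex.sin (π * -s / 2))) :=
    hasMellin_cpow_smul <| by
      rw [show 1 - s + -1 = -s by ring]
      exact hasMellin_one_add_sq_inv (by simpa using h1) (by simpa using neg_lt.1 h0)
  have heq := hlaplace.2.symm.trans (hasMellin_congr_Ioi hrational fun x hx => by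
    simp only [← Complex.ofReal_mul]
    rw [integral_complex_ofReal, integral_one_sub_cos_mul_exp_neg hx, Complex.cpow_neg_one]
    push_cast
    rfl).2
  rw [← heq, mul_div_cancel_right₀ _ (Complex.Gamma_ne_zero_of_re_pos hre)]

section EulerWeight

/-- The density of Euler's beta integral on `(0, 1)`, extended by zero. -/
noncomputable def eulerWeight (p q : ℝ) : ℝ → ℝ :=
  (Ioo (0 : ℝ) 1).indicator fun y => y ^ (p - 1) * (1 - y) ^ (q - 1)

variable {p q : ℝ}

@[fun_prop]
lemma measurable_eulerWeight : Measurable (eulerWeight p q) :=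
  Measurable.indicator (by fun_prop) measurableSet_Ioo

lemma eulerWeight_pos {y : ℝ} (hy : y ∈ Ioo (0 : ℝ) 1) : 0 < eulerWeight p q y := by
  rw [eulerWeight, indicator_of_mem hy]
  have hy0 := hy.1
  have hy1 := sub_pos.2 hy.2
  positivity

lemma eulerWeight_eq_zero {y : ℝ} (hy : y ∉ Ioo (0 : ℝ) 1) : eulerWeight p q y = 0 :=
  indicator_of_notMem hy _

lemma eulerWeight_nonneg (y : ℝ) : 0 ≤ eulerWeight p q y := by
  by_cases hy : y ∈ Ioo (0 : ℝ) 1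
  · exact (eulerWeight_pos hy).le
  · exact (eulerWeight_eq_zero hy).ge

lemma cpow_smul_eulerWeight (z : ℂ) :
    (fun y : ℝ => (y : ℂ) ^ (z - 1) • (eulerWeight p q y : ℂ)) = (Ioo (0 : ℝ) 1).indicator
      fun y => (y : ℂ) ^ ((p : ℂ) - 1 + z - 1) * (1 - (y : ℂ)) ^ ((q : ℂ) - 1) := by
  funext y
  by_cases hy : y ∈ Ioo (0 : ℝ) 1
  · have hy0 : (y : ℂ) ≠ 0 := Complex.ofReal_ne_zero.2 hy.1.ne'
    rw [eulerWeight, indicator_of_mem hy, indicator_of_mem hy]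
    push_cast
    rw [Complex.ofReal_cpow hy.1.le, Complex.ofReal_cpow (sub_pos.2 hy.2).le, smul_eq_mul,
      ← mul_assoc, ← Complex.cpow_add _ _ hy0]
    push_cast
    ring_nf
  · rw [eulerWeight_eq_zero hy, indicator_of_notMem hy, Complex.ofReal_zero, smul_zero]

lemma hasMellin_eulerWeight {z : ℂ} (hz : 0 < p - 1 + z.re) (hq : 0 < q) :
    HasMellin (fun y => (eulerWeight p q y : ℂ)) z (Complex.betaIntegral (p - 1 + z) q) := by
  have hbeta := Complex.betaIntegral_convergent (u := p - 1 + z) (v := q) (by simpa using hz)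
    (by simpa using hq)
  rw [intervalIntegrable_iff_integrableOn_Ioo_of_le zero_le_one] at hbeta
  constructor
  · rw [MellinConvergent, cpow_smul_eulerWeight]
    exact ((integrable_indicator_iff measurableSet_Ioo).2 hbeta).integrableOn
  · rw [mellin, cpow_smul_eulerWeight, setIntegral_indicator measurableSet_Ioo,
      inter_eq_right.2 Ioo_subset_Ioi_self, Complex.betaIntegral,
      intervalIntegral.integral_of_le zero_le_one, integral_Ioc_eq_integral_Ioo]

lemma integral_eulerWeight_mul_pow {n : ℕ} (hn : 0 < p + n) (hq : 0 < q) :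
    IntegrableOn (fun y => eulerWeight p q y * y ^ n) (Ioi 0) ∧
      ∫ y in Ioi (0 : ℝ), eulerWeight p q y * y ^ n =
        Real.Gamma (p + n) * Real.Gamma q / Real.Gamma (p + n + q) := by
  have hmellin := hasMellin_eulerWeight (p := p) (z := (n : ℂ) + 1)
    (by simp only [Complex.add_re, Complex.natCast_re, Complex.one_re]; linarith) hq
  have hcast (y : ℝ) : (y : ℂ) ^ ((n : ℂ) + 1 - 1) • (eulerWeight p q y : ℂ) =
      ((eulerWeight p q y * y ^ n : ℝ) : ℂ) := by
    rw [add_sub_cancel_right, Complex.cpow_natCast, smul_eq_mul, mul_comm]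
    push_cast
    rfl
  simp only [HasMellin, MellinConvergent, mellin, hcast, integral_complex_ofReal] at hmellin
  refine ⟨hmellin.1.re, Complex.ofReal_injective (hmellin.2.trans ?_)⟩
  rw [show (p : ℂ) - 1 + (n + 1) = ((p + n : ℝ) : ℂ) by push_cast; ring,
    Complex.betaIntegral_eq_Gamma_mul_div _ _ (by simpa using hn) (by simpa using hq),
    ← Complex.ofReal_add, Complex.Gamma_ofReal, Complex.Gamma_ofReal, Complex.Gamma_ofReal]
  push_cast
  rfl

end EulerWeight

section ErdelyiKober

/-- The Erdélyi–Kober fractional integral of order `q ≥ 0`, the average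
`Γ(q)⁻¹ ∫₀¹ y^(p-1) (1-y)^(q-1) f(xy) dy`. Order `q = 0` is the limiting case, the identity. -/
noncomputable def erdelyiKober (p q : ℝ) (f : ℝ → ℝ) (x : ℝ) : ℝ :=
  if q = 0 then f x else (Real.Gamma q)⁻¹ * ∫ y in Ioi (0 : ℝ), eulerWeight p q y * f (x * y)

variable {p q : ℝ} {f : ℝ → ℝ}

lemma erdelyiKober_zero : erdelyiKober p 0 f = f :=
  funext fun _ => if_pos rfl

lemma erdelyiKober_of_pos (hq : 0 < q) (x : ℝ) : erdelyiKober p q f x =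
    (Real.Gamma q)⁻¹ * ∫ y in Ioi (0 : ℝ), eulerWeight p q y * f (x * y) :=
  if_neg hq.ne'

lemma measurable_erdelyiKober (hf : Measurable f) : Measurable (erdelyiKober p q f) := by
  have hker : Measurable (Function.uncurry fun x y : ℝ => eulerWeight p q y * f (x * y)) := by
    simp only [Function.uncurry_def]
    fun_prop
  have hint := (hker.stronglyMeasurable.integral_prod_right
    (ν := volume.restrict (Ioi (0 : ℝ)))).measurable
  exact Measurable.ite (.const _) hf (hint.const_mul _)

lemma hasMellin_erdelyiKober {s F : ℂ} (hfm : Measurable f)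
    (hf : HasMellin (fun x => (f x : ℂ)) s F) (hs : s.re < p) (hq : 0 ≤ q) :
    HasMellin (fun x => (erdelyiKober p q f x : ℂ)) s
      (Complex.Gamma (p - s) / Complex.Gamma (p - s + q) * F) := by
  have hps : 0 < (p - s).re := by simpa using hs
  rcases hq.eq_or_lt with rfl | hq
  · rw [erdelyiKober_zero, Complex.ofReal_zero, add_zero,
      div_self (Complex.Gamma_ne_zero_of_re_pos hps), one_mul]
    exact hf
  have hweight := hasMellin_eulerWeight (p := p) (z := 1 - s) (by simpa using hs) hq
  rw [show (p : ℂ) - 1 + (1 - s) = p - s by ring,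
    Complex.betaIntegral_eq_Gamma_mul_div _ _ hps (by simpa using hq)] at hweight
  have hGamma : Complex.Gamma q ≠ 0 := Complex.Gamma_ne_zero_of_re_pos (by simpa using hq)
  convert hasMellin_const_mul (Complex.Gamma q)⁻¹
    (hasMellin_superposition (by fun_prop) (by fun_prop) hf hweight) using 1
  · funext x
    rw [erdelyiKober_of_pos hq, Complex.Gamma_ofReal]
    push_cast
    rw [← integral_complex_ofReal]
    push_cast
    rfl
  · field_simp

section PowerSeries

variable {ι : Type*} {c : ι → ℝ} {m : ι → ℕ} {M : ℕ}

lemma eulerWeight_mul_pow_le {y : ℝ} {n : ℕ} (hn : M ≤ n) :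
    eulerWeight p q y * y ^ n ≤ eulerWeight p q y * y ^ M := by
  by_cases hy : y ∈ Ioo (0 : ℝ) 1
  · exact mul_le_mul_of_nonneg_left (pow_le_pow_of_le_one hy.1.le hy.2.le hn)
      (eulerWeight_nonneg y)
  · simp only [eulerWeight_eq_zero hy, zero_mul, le_refl]

lemma norm_eulerWeight_mul (a x : ℝ) {y : ℝ} (hy : 0 < y) (n : ℕ) :
    ‖eulerWeight p q y * (a * (x * y) ^ n)‖ = ‖a * x ^ n‖ * (eulerWeight p q y * y ^ n) := by
  rw [mul_pow, ← mul_assoc a, mul_left_comm, norm_mul,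
    Real.norm_of_nonneg (mul_nonneg (eulerWeight_nonneg y) (pow_nonneg hy.le n))]

lemma integrableOn_eulerWeight_comp_mul (hfm : Measurable f) (hm : ∀ j, M ≤ m j) (hp : 0 < p + M)
    (hq : 0 < q) (hf : ∀ x, 0 < x → HasSum (fun j => c j * x ^ m j) (f x)) {x : ℝ} (hx : 0 < x) :
    IntegrableOn (fun y => eulerWeight p q y * f (x * y)) (Ioi 0) := by
  have hbound : ∀ y ∈ Ioi (0 : ℝ), ‖eulerWeight p q y * f (x * y)‖ ≤
      (∑' j, ‖c j * x ^ m j‖) * (eulerWeight p q y * y ^ M) := fun y hy => by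
    rw [← ((hf (x * y) (mul_pos hx hy)).mul_left (eulerWeight p q y)).tsum_eq]
    refine tsum_of_norm_bounded ((hf x hx).summable.norm.hasSum.mul_right _) fun j => ?_
    rw [norm_eulerWeight_mul _ _ hy]
    exact mul_le_mul_of_nonneg_left (eulerWeight_mul_pow_le (hm j)) (norm_nonneg _)
  exact Integrable.mono' ((integral_eulerWeight_mul_pow hp hq).1.const_mul _) (by fun_prop)
    (ae_restrict_of_forall_mem measurableSet_Ioi hbound)

lemma hasSum_integral_eulerWeight [Countable ι] (hm : ∀ j, M ≤ m j) (hp : 0 < p + M) (hq : 0 < q)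
    (hf : ∀ x, 0 < x → HasSum (fun j => c j * x ^ m j) (f x)) {x : ℝ} (hx : 0 < x) :
    HasSum (fun j => c j * x ^ m j * ∫ y in Ioi (0 : ℝ), eulerWeight p q y * y ^ m j)
      (∫ y in Ioi (0 : ℝ), eulerWeight p q y * f (x * y)) := by
  have hmoment (j : ι) : IntegrableOn (fun y => eulerWeight p q y * y ^ m j) (Ioi 0) :=
    (integral_eulerWeight_mul_pow (hp.trans_le (by gcongr; exact hm j)) hq).1
  have hterm (j : ι) (y : ℝ) : eulerWeight p q y * (c j * (x * y) ^ m j) =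
      c j * x ^ m j * (eulerWeight p q y * y ^ m j) := by
    rw [mul_pow]
    ring
  have hsummable : Summable fun j =>
      ∫ y in Ioi (0 : ℝ), ‖eulerWeight p q y * (c j * (x * y) ^ m j)‖ := by
    refine Summable.of_nonneg_of_le (fun j => integral_nonneg fun y => norm_nonneg _) (fun j => ?_)
      ((hf x hx).summable.norm.mul_right (∫ y in Ioi (0 : ℝ), eulerWeight p q y * y ^ M))
    rw [setIntegral_congr_fun measurableSet_Ioi fun y hy => norm_eulerWeight_mul (c j) x hy (m j),
      integral_const_mul]
    exact mul_le_mul_of_nonneg_left (setIntegral_mono (hmoment j)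
      (integral_eulerWeight_mul_pow hp hq).1 fun y => eulerWeight_mul_pow_le (hm j)) (norm_nonneg _)
  have hsum := hasSum_integral_of_summable_integral_norm
    (fun j => by simpa only [hterm] using (hmoment j).const_mul (c j * x ^ m j)) hsummable
  rw [setIntegral_congr_fun measurableSet_Ioi fun y hy =>
    ((hf (x * y) (mul_pos hx hy)).mul_left (eulerWeight p q y)).tsum_eq] at hsum
  simpa only [hterm, integral_const_mul] using hsum

lemma hasSum_erdelyiKober [Countable ι] (hm : ∀ j, M ≤ m j) (hp : 0 < p + M) (hq : 0 ≤ q)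
    (hf : ∀ x, 0 < x → HasSum (fun j => c j * x ^ m j) (f x)) {x : ℝ} (hx : 0 < x) :
    HasSum (fun j => Real.Gamma (p + m j) / Real.Gamma (p + m j + q) * (c j * x ^ m j))
      (erdelyiKober p q f x) := by
  have hpm (j : ι) : 0 < p + m j := hp.trans_le (by gcongr; exact hm j)
  rcases hq.eq_or_lt with rfl | hq
  · rw [erdelyiKober_zero]
    refine (hf x hx).congr_fun fun j => ?_
    rw [add_zero, div_self (Real.Gamma_pos_of_pos (hpm j)).ne', one_mul]
  · rw [erdelyiKober_of_pos hq]
    refine ((hasSum_integral_eulerWeight hm hp hq hf hx).mul_left _).congr_fun fun j => ?_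
    rw [(integral_eulerWeight_mul_pow (hpm j) hq).2]
    field_simp [(Real.Gamma_pos_of_pos hq).ne']

end PowerSeries

lemma erdelyiKober_nonneg (hq : 0 ≤ q) (hf : ∀ y, 0 < y → 0 ≤ f y) {x : ℝ} (hx : 0 < x) :
    0 ≤ erdelyiKober p q f x := by
  rcases hq.eq_or_lt with rfl | hq
  · rw [erdelyiKober_zero]
    exact hf x hx
  · rw [erdelyiKober_of_pos hq]
    exact mul_nonneg (inv_nonneg.2 (Real.Gamma_pos_of_pos hq).le) (setIntegral_nonneg
      measurableSet_Ioi fun y hy => mul_nonneg (eulerWeight_nonneg y) (hf _ (mul_pos hx hy)))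

lemma erdelyiKober_pos (hq : 0 < q) (hf : ∀ y, 0 < y → 0 ≤ f y) (hf0 : ∀ᶠ y in 𝓝[>] 0, 0 < f y)
    {x : ℝ} (hx : 0 < x) (hint : IntegrableOn (fun y => eulerWeight p q y * f (x * y)) (Ioi 0)) :
    0 < erdelyiKober p q f x := by
  obtain ⟨δ, hδ : 0 < δ, hfδ⟩ := mem_nhdsGT_iff_exists_Ioo_subset.1 hf0
  have hnonneg : ∀ y ∈ Ioi (0 : ℝ), 0 ≤ eulerWeight p q y * f (x * y) := fun y hy =>
    mul_nonneg (eulerWeight_nonneg y) (hf _ (mul_pos hx hy))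
  have hpos : ∀ y ∈ Ioo 0 (min 1 (δ / x)), 0 < eulerWeight p q y * f (x * y) := fun y hy =>
    mul_pos (eulerWeight_pos ⟨hy.1, hy.2.trans_le (min_le_left _ _)⟩)
      (hfδ ⟨mul_pos hx hy.1, (lt_div_iff₀' hx).1 (hy.2.trans_le (min_le_right _ _))⟩)
  rw [erdelyiKober_of_pos hq]
  refine mul_pos (inv_pos.2 (Real.Gamma_pos_of_pos hq)) ?_
  rw [setIntegral_pos_iff_support_of_nonneg_ae
    (ae_restrict_of_forall_mem measurableSet_Ioi hnonneg) hint]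
  calc 0 < volume (Ioo 0 (min 1 (δ / x))) := by simp [hx, hδ]
    _ ≤ volume (Function.support (fun y => eulerWeight p q y * f (x * y)) ∩ Ioi 0) :=
      measure_mono fun y hy => ⟨(hpos y hy).ne', hy.1⟩

end ErdelyiKober

section Lommel

lemma hasSum_one_sub_cos (x : ℝ) :
    HasSum (fun j : ℕ => (-1) ^ j / ((2 * j + 2).factorial : ℝ) * x ^ (2 * j + 2))
      (1 - Real.cos x) := by
  have hcos := ((hasSum_nat_add_iff' 1).2 (Real.hasSum_cos x)).neg
  simp only [Finset.range_one, Finset.sum_singleton, mul_zero, pow_zero, Nat.factorial_zero,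
    Nat.cast_one, div_one, mul_one, neg_sub] at hcos
  refine hcos.congr_fun fun j => ?_
  rw [mul_add, mul_one, pow_succ]
  ring

lemma one_sub_cos_nonneg (x : ℝ) : 0 ≤ 1 - Real.cos x :=
  sub_nonneg.2 x.cos_le_one

lemma eventually_one_sub_cos_pos : ∀ᶠ x in 𝓝[>] 0, 0 < 1 - Real.cos x := by
  filter_upwards [Ioo_mem_nhdsGT Real.pi_pos] with x hx
  rw [sub_pos, ← Real.cos_zero]
  exact Real.cos_lt_cos_of_nonneg_of_le_pi le_rfl hx.2.le hx.1

/-- The entire function `∑ (-1)^j x^(2j+2) / Γ(a + 2j + 3)`; up to a power of `x` it is a Lommel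
function. It is defined by its fractional integral representation, which makes its sign visible. -/
noncomputable def lommel (a : ℝ) : ℝ → ℝ :=
  erdelyiKober 1 a fun x => 1 - Real.cos x

/-- The average `∫₀¹ y^(a-3/2) lommel a (xy) dy`, which divides the coefficient of `x^(2j+2)` by
`2j + 2 + a - 1/2`. -/
noncomputable def lommelAverage (a : ℝ) : ℝ → ℝ :=
  erdelyiKober (a - 1 / 2) 1 (lommel a)

variable {a : ℝ}

lemma measurable_lommel : Measurable (lommel a) :=
  measurable_erdelyiKober (by fun_prop)

lemma hasSum_lommel (ha : 0 ≤ a) {x : ℝ} (hx : 0 < x) :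
    HasSum (fun j : ℕ => (-1) ^ j / Real.Gamma (a + 2 * j + 3) * x ^ (2 * j + 2))
      (lommel a x) := by
  refine (hasSum_erdelyiKober (m := fun j : ℕ => 2 * j + 2) (M := 2) (fun j => by lia)
    (by norm_num) ha (fun x _ => hasSum_one_sub_cos x) hx).congr_fun fun j => ?_
  rw [add_comm 1, Real.Gamma_nat_eq_factorial,
    show ((2 * j + 2 : ℕ) : ℝ) + 1 + a = a + 2 * j + 3 by push_cast; ring]
  field_simp

lemma lommel_nonneg (ha : 0 ≤ a) {x : ℝ} (hx : 0 < x) : 0 ≤ lommel a x :=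
  erdelyiKober_nonneg ha (fun y _ => one_sub_cos_nonneg y) hx

lemma eventually_lommel_pos (ha : 0 ≤ a) : ∀ᶠ x in 𝓝[>] 0, 0 < lommel a x := by
  rcases ha.eq_or_lt with rfl | ha
  · rw [lommel, erdelyiKober_zero]
    exact eventually_one_sub_cos_pos
  · filter_upwards [self_mem_nhdsWithin] with x hx
    exact erdelyiKober_pos ha (fun y _ => one_sub_cos_nonneg y) eventually_one_sub_cos_pos hx
      (integrableOn_eulerWeight_comp_mul (m := fun j : ℕ => 2 * j + 2) (M := 2) (by fun_prop)
        (fun j => by lia) (by norm_num) ha (fun x _ => hasSum_one_sub_cos x) hx)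

lemma hasMellin_lommel (ha : 0 ≤ a) {s : ℂ} (h0 : -2 < s.re) (h1 : s.re < 0) :
    HasMellin (fun x => (lommel a x : ℂ)) s
      (π / (2 * Complex.sin (π * -s / 2)) / Complex.Gamma (1 - s + a)) := by
  have hGamma : Complex.Gamma (1 - s) ≠ 0 := Complex.Gamma_ne_zero_of_re_pos (by
    rw [Complex.sub_re, Complex.one_re]; linarith)
  convert hasMellin_erdelyiKober (p := 1) (by fun_prop) (hasMellin_one_sub_cos h0 h1)
    (by linarith) ha using 1
  · rfl
  · rw [Complex.ofReal_one, mul_comm (_ / _), div_mul_div_cancel₀ hGamma]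

lemma hasSum_lommelAverage (ha : 0 ≤ a) {x : ℝ} (hx : 0 < x) :
    HasSum (fun j : ℕ => (-1) ^ j / Real.Gamma (a + 2 * j + 3) * x ^ (2 * j + 2) /
      (2 * j + 2 + a - 1 / 2)) (lommelAverage a x) := by
  refine (hasSum_erdelyiKober (m := fun j : ℕ => 2 * j + 2) (M := 2) (fun j => by lia)
    (by push_cast; linarith) zero_le_one (fun x hx => hasSum_lommel ha hx) hx).congr_fun
    fun j => ?_
  have hp : 0 < a - 1 / 2 + ((2 * j + 2 : ℕ) : ℝ) := by
    push_cast
    linarith [j.cast_nonneg (α := ℝ)]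
  rw [Real.Gamma_add_one hp.ne', div_mul_cancel_right₀ (Real.Gamma_pos_of_pos hp).ne',
    show 2 * (j : ℝ) + 2 + a - 1 / 2 = a - 1 / 2 + ((2 * j + 2 : ℕ) : ℝ) by push_cast; ring,
    mul_comm _⁻¹, div_eq_mul_inv]

lemma lommelAverage_pos (ha : 0 ≤ a) {x : ℝ} (hx : 0 < x) : 0 < lommelAverage a x :=
  erdelyiKober_pos one_pos (fun _ hy => lommel_nonneg ha hy) (eventually_lommel_pos ha) hx
    (integrableOn_eulerWeight_comp_mul (m := fun j : ℕ => 2 * j + 2) (M := 2) measurable_lommel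
      (fun j => by lia) (by push_cast; linarith) one_pos (fun _ hx => hasSum_lommel ha hx) hx)

lemma hasMellin_lommelAverage (ha : 0 ≤ a) {s : ℂ} (h0 : -2 < s.re) (h1 : s.re < 0)
    (h2 : s.re < a - 1 / 2) :
    HasMellin (fun x => (lommelAverage a x : ℂ)) s
      (π / (2 * Complex.sin (π * -s / 2)) / Complex.Gamma (1 - s + a) / (a - 1 / 2 - s)) := by
  have hre : 0 < (((a - 1 / 2 : ℝ) : ℂ) - s).re := by
    rwa [Complex.sub_re, Complex.ofReal_re, sub_pos]
  convert hasMellin_erdelyiKober measurable_lommel (hasMellin_lommel ha h0 h1) h2 zero_le_one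
    using 1
  · rfl
  · rw [Complex.ofReal_one, Complex.Gamma_add_one _ (Complex.ne_zero_of_re_pos hre),
      div_mul_cancel_right₀ (Complex.Gamma_ne_zero_of_re_pos hre), mul_comm _⁻¹, div_eq_mul_inv]
    push_cast
    rfl

end Lommel

lemma hasSum_tsum_of_fiberwise {ι κ α : Type*} [AddCommMonoid α] [TopologicalSpace α]
    [ContinuousAdd α] [T3Space α] {f : ι × κ → α} {g : ι → α} {h : κ → α}
    (hf : Summable f) (hg : ∀ i, HasSum (fun k => f (i, k)) (g i))
    (hh : ∀ k, HasSum (fun i => f (i, k)) (h k)) : HasSum g (∑' k, h k) := by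
  rw [(((Equiv.prodComm κ ι).hasSum_iff.2 hf.hasSum).prod_fiberwise hh).tsum_eq]
  exact hf.hasSum.prod_fiberwise hg

lemma hasSum_pnat_cpow_neg {s : ℂ} (hs : 1 < s.re) :
    HasSum (fun n : ℕ+ => ((n : ℕ) : ℂ) ^ (-s)) (riemannZeta s) := by
  have hsum := ((summable_nat_add_iff 1).2 (Complex.summable_one_div_nat_cpow.2 hs)).hasSum
  push_cast at hsum
  rw [← zeta_eq_tsum_one_div_nat_add_one_cpow hs] at hsum
  refine Equiv.pnatEquivNat.symm.hasSum_iff.1 (hsum.congr_fun fun n => ?_)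
  simp [Complex.cpow_neg]

lemma one_le_norm_riemannZeta {x : ℝ} (hx : 1 < x) : 1 ≤ ‖riemannZeta x‖ := by
  have hsum := Complex.hasSum_re (hasSum_pnat_cpow_neg (s := x) (by simpa using hx))
  have hfirst := le_hasSum hsum 1 fun n _ => by
    rw [← Complex.ofReal_neg, ← Complex.ofReal_natCast, ← Complex.ofReal_cpow (Nat.cast_nonneg _),
      Complex.ofReal_re]
    positivity
  simp only [PNat.one_coe, Nat.cast_one, Complex.one_cpow, Complex.one_re] at hfirst
  exact hfirst.trans (Complex.re_le_norm _)

section Terms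

lemma poch_eq_ascPochhammer_eval (z : ℂ) (n : ℕ) : poch z n = (ascPochhammer ℂ n).eval z := by
  induction n with
  | zero => simp [poch]
  | succ n ih => rw [ascPochhammer_succ_eval, ← ih, poch, Finset.prod_range_succ, poch]

lemma Gamma_mul_poch {z : ℂ} (hz : ∀ m : ℕ, z ≠ -m) (n : ℕ) :
    Complex.Gamma z * poch z n = Complex.Gamma (z + n) := by
  rw [poch_eq_ascPochhammer_eval, ← Complex.Gamma_add_nat_div_Gamma_eq z hz,
    mul_div_cancel₀ _ (Complex.Gamma_ne_zero hz)]

lemma pi_mul_I_mul_pow (r : ℝ) (k : ℕ) :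
    ((π : ℂ) * (Complex.I * r)) ^ (2 * k) = (-1) ^ k * (π * r : ℂ) ^ (2 * k) := by
  rw [mul_left_comm, mul_pow, pow_mul Complex.I, Complex.I_sq]

lemma norm_T0Term_le_of_norm_le {z z' : ℂ} (h : ‖z‖ ≤ ‖z'‖) (β : ℂ) (k : ℕ) :
    ‖T0Term z β k‖ ≤ ‖T0Term z' β k‖ := by
  simp only [T0Term, norm_div, norm_pow, norm_mul]
  gcongr

variable {β : ℝ} {k : ℕ}

lemma one_le_norm_riemannZeta_even (hk : 1 < 2 * β + 4 * k) :
    1 ≤ ‖riemannZeta (2 * β + 4 * k)‖ := by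
  simpa using one_le_norm_riemannZeta hk

lemma norm_PTerm_le (z : ℂ) (hk : 1 < 2 * β + 4 * k) : ‖PTerm z β k‖ ≤ ‖T0Term z β k‖ := by
  have hz : ‖z‖ ≤ ‖(π * z : ℂ)‖ := by
    rw [norm_mul, Complex.norm_real, Real.norm_of_nonneg Real.pi_pos.le]
    exact le_mul_of_one_le_left (norm_nonneg z) (by linarith [Real.pi_gt_three])
  rw [PTerm, T0Term, ← div_div, norm_div]
  refine (div_le_self (norm_nonneg _) (one_le_norm_riemannZeta_even hk)).trans ?_
  rw [norm_div, norm_div, norm_mul, norm_pow, norm_neg, norm_one, one_pow, one_mul, norm_pow,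
    norm_pow]
  gcongr

lemma cpow_mul_PTerm (r : ℝ) (k : ℕ) (n : ℕ+) :
    ((n : ℕ) : ℂ) ^ (-(2 * (β : ℂ))) * PTerm ((π * r / ((n : ℕ) : ℝ) ^ 2 : ℝ) : ℂ) β k =
      T0Term (Complex.I * r) β k *
        (((n : ℕ) : ℂ) ^ (-(2 * (β : ℂ) + 4 * k)) / riemannZeta (2 * β + 4 * k)) := by
  have hn : ((n : ℕ) : ℂ) ≠ 0 := Nat.cast_ne_zero.2 n.ne_zero
  rw [T0Term, PTerm, pi_mul_I_mul_pow, neg_add, Complex.cpow_add _ _ hn,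
    Complex.cpow_neg _ (4 * k), show (4 * k : ℂ) = ((4 * k : ℕ) : ℂ) by push_cast; rfl,
    Complex.cpow_natCast, show 4 * k = 2 * (2 * k) by ring, pow_mul _ 2 (2 * k)]
  push_cast
  simp only [div_eq_mul_inv, mul_inv, mul_pow, inv_pow]
  ring

lemma hasSum_cpow_mul_PTerm (r : ℝ) (hk : 1 < 2 * β + 4 * k) :
    HasSum (fun n : ℕ+ => ((n : ℕ) : ℂ) ^ (-(2 * (β : ℂ))) *
      PTerm ((π * r / ((n : ℕ) : ℝ) ^ 2 : ℝ) : ℂ) β k) (T0Term (Complex.I * r) β k) := by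
  have hzeta : riemannZeta (2 * β + 4 * k) ≠ 0 :=
    norm_pos_iff.1 (one_pos.trans_le (one_le_norm_riemannZeta_even hk))
  have hsum := ((hasSum_pnat_cpow_neg (s := 2 * β + 4 * k) (by simpa using hk)).div_const
    (riemannZeta (2 * β + 4 * k))).mul_left (T0Term (Complex.I * r) β k)
  rw [div_self hzeta, mul_one] at hsum
  exact hsum.congr_fun (cpow_mul_PTerm r k)

lemma norm_cpow_mul_PTerm_le (r : ℝ) (hk : 2 ≤ 2 * β + 4 * k) (n : ℕ+) :
    ‖((n : ℕ) : ℂ) ^ (-(2 * (β : ℂ))) * PTerm ((π * r / ((n : ℕ) : ℝ) ^ 2 : ℝ) : ℂ) β k‖ ≤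
      ((n : ℕ) : ℝ) ^ (-2 : ℝ) * ‖T0Term (Complex.I * r) β k‖ := by
  have hn : (1 : ℝ) ≤ ((n : ℕ) : ℝ) := Nat.one_le_cast.2 n.pos
  have hre : (-(2 * (β : ℂ) + 4 * k)).re ≤ -2 := by simpa using hk
  have hzeta := one_le_norm_riemannZeta_even (β := β) (k := k) (by linarith)
  rw [cpow_mul_PTerm, norm_mul, norm_div, Complex.norm_natCast_cpow_of_pos n.pos, mul_comm]
  gcongr
  exact (div_le_self (by positivity) hzeta).trans (Real.rpow_le_rpow_of_exponent_le hn hre)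

end Terms

section Profile

variable {β : ℝ} {w : ℕ}

lemma T0Term_I_mul (hβ : ∀ n : ℕ, 1 + β ≠ -n) (r : ℝ) (j : ℕ) :
    T0Term (Complex.I * r) β (j + (w + 1)) = (-1) ^ (w + 1) * Complex.Gamma (1 + β) *
      (((π * r) ^ (2 * w) * ((-1) ^ j / Real.Gamma (β + 2 * w + 2 * j + 3) *
        (π * r) ^ (2 * j + 2) / (2 * j + 2 + (β + 2 * w) - 1 / 2)) : ℝ) : ℂ) := by
  have hβ' (n : ℕ) : (1 + β : ℂ) ≠ -n := mod_cast hβ n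
  have hpoch : poch (1 + β) (2 * (j + (w + 1))) =
      Real.Gamma (β + 2 * w + 2 * j + 3) / Complex.Gamma (1 + β) := by
    rw [eq_div_iff (Complex.Gamma_ne_zero hβ'), mul_comm, Gamma_mul_poch hβ',
      ← Complex.Gamma_ofReal]
    push_cast
    ring_nf
  rw [T0Term, pi_mul_I_mul_pow, hpoch]
  push_cast
  rw [show 2 * ((j : ℂ) + (w + 1)) + β - 1 / 2 = 2 * j + 2 + (β + 2 * w) - 1 / 2 by ring]
  simp only [div_eq_mul_inv, mul_inv, inv_inv]
  ring

lemma hasSum_T0Term_I_mul (hβw : 0 ≤ β + 2 * w) (hβ : ∀ n : ℕ, 1 + β ≠ -n) {r : ℝ} (hr : 0 < r) :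
    HasSum (fun j : ℕ => T0Term (Complex.I * r) β (j + (w + 1)))
      ((-1) ^ (w + 1) * Complex.Gamma (1 + β) *
        (((π * r) ^ (2 * w) * lommelAverage (β + 2 * w) (π * r) : ℝ) : ℂ)) :=
  ((Complex.hasSum_ofReal.2 ((hasSum_lommelAverage hβw (mul_pos Real.pi_pos hr)).mul_left
    ((π * r) ^ (2 * w)))).mul_left _).congr_fun fun j => T0Term_I_mul hβ r j

lemma T0_I_mul (hβw : 0 ≤ β + 2 * w) (hβ : ∀ n : ℕ, 1 + β ≠ -n) {r : ℝ} (hr : 0 < r) :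
    T0 (Complex.I * r) β w =
      ((π ^ (β - 1) * ((π * r) ^ (2 * w) * lommelAverage (β + 2 * w) (π * r)) : ℝ) : ℂ) := by
  have hGamma : Complex.Gamma (1 + β) ≠ 0 := Complex.Gamma_ne_zero fun n => mod_cast hβ n
  have hsign : (-1 : ℂ) ^ (w + 1) * (-1) ^ (w + 1) = 1 := by rw [← mul_pow]; simp
  have hpi : ((π ^ (β - 1) : ℝ) : ℂ) = ((π : ℂ) ^ (1 - β : ℂ))⁻¹ := by
    rw [Complex.ofReal_cpow Real.pi_pos.le, ← Complex.cpow_neg]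
    push_cast
    rw [neg_sub]
  rw [T0, (hasSum_T0Term_I_mul hβw hβ hr).tsum_eq, ← mul_assoc,
    Complex.ofReal_mul (π ^ (β - 1)), hpi]
  congr 1
  field_simp
  linear_combination hsign

lemma T0_pos (hβw : 0 ≤ β + 2 * w) (hβ : ∀ n : ℕ, 1 + β ≠ -n) {r : ℝ} (hr : 0 < r) :
    0 < T0 (Complex.I * r) β w := by
  have hL := lommelAverage_pos hβw (mul_pos Real.pi_pos hr)
  rw [T0_I_mul hβw hβ hr, Complex.zero_lt_real]
  positivity

lemma summable_T0Term (hβw : 0 ≤ β + 2 * w) (hβ : ∀ n : ℕ, 1 + β ≠ -n) (z : ℂ) :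
    Summable fun j : ℕ => T0Term z β (j + (w + 1)) := by
  have hr : 0 < ‖z‖ + 1 := by positivity
  refine Summable.of_norm_bounded (hasSum_T0Term_I_mul hβw hβ hr).summable.norm
    fun j => norm_T0Term_le_of_norm_le ?_ _ _
  rw [norm_mul, Complex.norm_I, one_mul, Complex.norm_real, Real.norm_of_nonneg hr.le]
  exact (lt_add_one _).le

lemma two_le_two_mul_add (hβw : 0 ≤ β + 2 * w) (j : ℕ) :
    2 ≤ 2 * β + 4 * ((j + (w + 1) : ℕ) : ℝ) := by
  push_cast
  linarith [j.cast_nonneg (α := ℝ)]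

lemma summable_PTerm (hβw : 0 ≤ β + 2 * w) (hβ : ∀ n : ℕ, 1 + β ≠ -n) (z : ℂ) :
    Summable fun j : ℕ => PTerm z β (j + (w + 1)) :=
  Summable.of_norm_bounded (summable_T0Term hβw hβ z).norm
    fun j => norm_PTerm_le z (one_lt_two.trans_le (two_le_two_mul_add hβw j))

lemma hasSum_T0_of_P (hβw : 0 ≤ β + 2 * w) (hβ : ∀ n : ℕ, 1 + β ≠ -n) (r : ℝ) :
    HasSum (fun n : ℕ+ => ((n : ℕ) : ℂ) ^ (-(2 * (β : ℂ))) *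
      P w ((π * r / ((n : ℕ) : ℝ) ^ 2 : ℝ) : ℂ) β) (T0 (Complex.I * r) β w) := by
  have hexp (j : ℕ) := two_le_two_mul_add hβw j
  have hn : Summable fun n : ℕ+ => ((n : ℕ) : ℝ) ^ (-2 : ℝ) :=
    (Real.summable_nat_rpow.2 (by norm_num)).comp_injective PNat.coe_injective
  have hsum : Summable fun q : ℕ+ × ℕ => ((q.1 : ℕ) : ℂ) ^ (-(2 * (β : ℂ))) *
      PTerm ((π * r / ((q.1 : ℕ) : ℝ) ^ 2 : ℝ) : ℂ) β (q.2 + (w + 1)) :=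
    Summable.of_norm_bounded (hn.mul_of_nonneg (summable_T0Term hβw hβ (Complex.I * r)).norm
      (fun n => by positivity) fun _ => norm_nonneg _)
      fun q => norm_cpow_mul_PTerm_le r (hexp q.2) q.1
  have hrows (n : ℕ+) :=
    (summable_PTerm hβw hβ ((π * r / ((n : ℕ) : ℝ) ^ 2 : ℝ) : ℂ)).hasSum.mul_left
      (((n : ℕ) : ℂ) ^ (-(2 * (β : ℂ))))
  have hcolumns (j : ℕ) := hasSum_cpow_mul_PTerm (β := β) r (one_lt_two.trans_le (hexp j))
  refine ((hasSum_tsum_of_fiberwise hsum hrows hcolumns).mul_left _).congr_fun fun n => ?_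
  rw [P, mul_left_comm]

lemma T0_pos_of_P_pos (hβw : 0 ≤ β + 2 * w) (hβ : ∀ n : ℕ, 1 + β ≠ -n)
    (hP : ∀ r : ℝ, 0 < r → 0 < P w r β) {r : ℝ} (hr : 0 < r) : 0 < T0 (Complex.I * r) β w := by
  have hpos (n : ℕ+) : 0 < ((n : ℕ) : ℂ) ^ (-(2 * (β : ℂ))) *
      P w ((π * r / ((n : ℕ) : ℝ) ^ 2 : ℝ) : ℂ) β := by
    have hn : (0 : ℝ) < ((n : ℕ) : ℝ) := Nat.cast_pos.2 n.pos
    have hcpow : ((n : ℕ) : ℂ) ^ (-(2 * (β : ℂ))) = ((((n : ℕ) : ℝ) ^ (-(2 * β)) : ℝ) : ℂ) := by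
      rw [Complex.ofReal_cpow hn.le]
      push_cast
      rfl
    rw [hcpow]
    exact mul_pos (Complex.zero_lt_real.2 (Real.rpow_pos_of_pos hn _)) (hP _ (by positivity))
  exact (hpos 1).trans_le (le_hasSum (hasSum_T0_of_P hβw hβ r) 1 fun n _ => (hpos n).le)

lemma hasMellin_T0_I_mul (hβw : 0 ≤ β + 2 * w) (hβ : ∀ n : ℕ, 1 + β ≠ -n) {s : ℂ}
    (h0 : -2 < s.re + 2 * w) (h1 : s.re + 2 * w < 0) (h2 : s.re < β - 1 / 2) :
    HasMellin (fun u : ℝ => T0 (Complex.I * u) β w) s ((-1) ^ w * (π : ℂ) ^ (β - s) /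
      (2 * Complex.sin (π * -s / 2) * Complex.Gamma (1 - s + β) * (β - 1 / 2 - s))) := by
  have hre : (s + 2 * w).re = s.re + 2 * w := by simp
  have hL := hasMellin_const_mul ((π ^ (β - 1) : ℝ) : ℂ) (hasMellin_comp_mul_left Real.pi_pos
    (hasMellin_cpow_smul (hasMellin_lommelAverage hβw (s := s + 2 * w) (by rwa [hre])
      (by rwa [hre]) (by rw [hre]; linarith))))
  have hT0 : EqOn (fun u : ℝ => ((π ^ (β - 1) : ℝ) : ℂ) *
      (((π * u : ℝ) : ℂ) ^ (2 * w : ℂ) • (lommelAverage (β + 2 * w) (π * u) : ℂ)))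
      (fun u : ℝ => T0 (Complex.I * u) β w) (Ioi 0) := fun u hu => by
    simp only [T0_I_mul hβw hβ hu, smul_eq_mul]
    rw [show (2 * w : ℂ) = ((2 * w : ℕ) : ℂ) by push_cast; rfl, Complex.cpow_natCast]
    push_cast
    rfl
  convert hasMellin_congr_Ioi hL hT0 using 1
  have hsin : Complex.sin (π * -(s + 2 * w) / 2) = (-1) ^ w * Complex.sin (π * -s / 2) := by
    rw [← Complex.sin_antiperiodic.sub_nat_mul_eq]
    ring_nf
  have hsign : ((-1 : ℂ) ^ w)⁻¹ = (-1) ^ w := by rw [← inv_pow, inv_neg_one]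
  have hpi : (π : ℂ) ^ (β - s : ℂ) = (π ^ (β - 1) : ℝ) * (π : ℂ) ^ (-s) * π := by
    have hpi0 : (π : ℂ) ≠ 0 := Complex.ofReal_ne_zero.2 Real.pi_ne_zero
    nth_rewrite 3 [← Complex.cpow_one (π : ℂ)]
    rw [Complex.ofReal_cpow Real.pi_pos.le, ← Complex.cpow_add _ _ hpi0,
      ← Complex.cpow_add _ _ hpi0]
    push_cast
    ring_nf
  rw [hsin, hpi]
  push_cast
  rw [show 1 - (s + 2 * w) + (β + 2 * w) = 1 - s + β by ring,
    show (β : ℂ) + 2 * w - 1 / 2 - (s + 2 * w) = β - 1 / 2 - s by ring]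
  simp only [div_eq_mul_inv, mul_inv, hsign, smul_eq_mul]
  ring

lemma hasMellin_T0 (hβw : 0 ≤ β + 2 * w) (hβ : ∀ n : ℕ, 1 + β ≠ -n) {s : ℂ}
    (hl : max (4 * (w : ℝ)) (1 - 2 * β) < s.re) (hr : s.re < 4 * ((w : ℝ) + 1)) :
    HasMellin (fun v : ℝ => T0 (Complex.I * ((v ^ 2)⁻¹ : ℝ)) β w) s ((-1) ^ w / b s β) := by
  obtain ⟨hl0, hl1⟩ := max_lt_iff.1 hl
  have hre : (s / ((-2 : ℝ) : ℂ)).re = -s.re / 2 := by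
    rw [Complex.div_ofReal_re]
    ring
  have hT0 := hasMellin_comp_rpow (a := -2) (by norm_num) (hasMellin_T0_I_mul hβw hβ
    (s := s / ((-2 : ℝ) : ℂ)) (by rw [hre]; linarith) (by rw [hre]; linarith)
    (by rw [hre]; linarith))
  convert hasMellin_congr_Ioi hT0 (g := fun v : ℝ => T0 (Complex.I * ((v ^ 2)⁻¹ : ℝ)) β w)
    fun v hv => by rw [Real.rpow_neg (le_of_lt hv), Real.rpow_two] using 1
  have hs : s / ((-2 : ℝ) : ℂ) = -(s / 2) := by
    push_cast
    ring
  rw [hs, b, n0, l, show -(2 * β + s) / 2 = -(β - -(s / 2)) by ring, Complex.cpow_neg,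
    show (π : ℂ) * - -(s / 2) / 2 = π * s / 4 by ring,
    show (1 : ℂ) - -(s / 2) + β = 1 + (2 * β + s) / 2 by ring,
    show (β : ℂ) - 1 / 2 - -(s / 2) = (2 * β + s - 1) / 2 by ring, Complex.real_smul]
  have habs : |(-2 : ℝ)|⁻¹ = 2⁻¹ := by norm_num
  rw [habs]
  push_cast
  simp only [div_eq_mul_inv, mul_inv, inv_inv]
  ring

end Profile

end ZetaMellin

theorem lemma6p1_general (β : ℝ) (w : ℕ) (hβw : 0 ≤ β + 2 * w) (hβ : ∀ n : ℕ, 1 + β ≠ -n) :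
    (∀ z : ℂ, Summable (fun j : ℕ => ZetaMellin.T0Term z β (j + (w + 1))) ∧
      Summable (fun j : ℕ => ZetaMellin.PTerm z β (j + (w + 1)))) ∧
    (∀ s : ℂ, max (4 * (w : ℝ)) (1 - 2 * β) < s.re → s.re < 4 * ((w : ℝ) + 1) →
      HasMellin (fun v : ℝ => ZetaMellin.T0 (Complex.I * ((v ^ 2)⁻¹ : ℝ)) β w) s
        ((-1) ^ w / ZetaMellin.b s β)) ∧
    ((∀ r : ℝ, 0 < r → 0 < ZetaMellin.P w r β) →
      ∀ r : ℝ, 0 < r → 0 < ZetaMellin.T0 (Complex.I * r) β w) ∧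
    (∀ r : ℝ, 0 < r → 0 < ZetaMellin.T0 (Complex.I * r) β w) ∧
    (∀ r : ℝ, 0 < r →
      HasSum (fun n : ℕ+ => ((n : ℕ) : ℂ) ^ (-(2 * (β : ℂ))) *
          ZetaMellin.P w ((Real.pi * r / ((n : ℕ) : ℝ) ^ 2 : ℝ) : ℂ) β)
        (ZetaMellin.T0 (Complex.I * r) β w)) :=
  ⟨fun z => ⟨ZetaMellin.summable_T0Term hβw hβ z, ZetaMellin.summable_PTerm hβw hβ z⟩,
    fun _ hl hr => ZetaMellin.hasMellin_T0 hβw hβ hl hr,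
    fun hP _ hr => ZetaMellin.T0_pos_of_P_pos hβw hβ hP hr,
    fun _ hr => ZetaMellin.T0_pos hβw hβ hr,
    fun r _ => ZetaMellin.hasSum_T0_of_P hβw hβ r⟩

theorem lemma6p1 (β : ℝ) (hβ : 0 ≤ β) (w : ℕ) :
    -- the two defining series converge absolutely everywhere
    (∀ z : ℂ, Summable (fun j : ℕ => ZetaMellin.T0Term z β (j + (w + 1))) ∧
      Summable (fun j : ℕ => ZetaMellin.PTerm z β (j + (w + 1)))) ∧
    -- `T₀(i v⁻², β, 4w)` is the Mellin density of `(-1)^w / b(s, β)`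
    (∀ s : ℂ, max (4 * (w : ℝ)) (1 - 2 * β) < s.re → s.re < 4 * ((w : ℝ) + 1) →
      HasMellin (fun v : ℝ => ZetaMellin.T0 (Complex.I * ((v ^ 2)⁻¹ : ℝ)) β w) s
        ((-1) ^ w / ZetaMellin.b s β)) ∧
    -- positivity of `P_{4w}` implies that of `T₀`
    ((∀ r : ℝ, 0 < r → 0 < ZetaMellin.P w r β) →
      ∀ r : ℝ, 0 < r → 0 < ZetaMellin.T0 (Complex.I * r) β w) ∧
    -- positivity of `T₀`
    (∀ r : ℝ, 0 < r → 0 < ZetaMellin.T0 (Complex.I * r) β w) ∧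
    -- `T₀` as a series in `P_{4w}`
    (∀ r : ℝ, 0 < r →
      HasSum (fun n : ℕ+ => ((n : ℕ) : ℂ) ^ (-(2 * (β : ℂ))) *
          ZetaMellin.P w ((Real.pi * r / ((n : ℕ) : ℝ) ^ 2 : ℝ) : ℂ) β)
        (ZetaMellin.T0 (Complex.I * r) β w)) :=
  lemma6p1_general β w (by positivity) fun n => by linarith [n.cast_nonneg (α := ℝ)]
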